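/- Let $(\lambda_n)_{n\in\mathbb N}$ be a sequence of positive reals with counting function $\mathcal N(\lambda)=\#\{n:\lambda_n>\lambda\}$, and let $\xi_n$, $n\in\mathbb N$, be independent standard normal random variables. Suppose that $\mathcal N(\lambda)\sim\varphi(\lambda)$ as $\lambda\to0^+$, where the real function $\varphi$ is integrable on $[x,1]$ for every $x\in(0,1)$ and slowly varying at zero, that is, $\varphi$ is positive near $0$ and $\lim_{t\to0^+}\varphi(ct)/\varphi(t)=1$ for every $c>0$. Let $u=u(r)$ be any function with $u(r)\to\infty$ and $$\frac{\varphi(1/u(r))}{2u(r)}\sim r\qquad\text{as } r\to0^+.$$ Then, as $r\to0^+$, $$\ln \mathbf P\Big\{\sum_{n}\lambda_n\xi_n^2\le r\Big\}\sim-\frac12\int_{1/u(r)}^1\varphi(z)\,\frac{dz}{z}.$$ -/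

import Mathlib

open MeasureTheory ProbabilityTheory Filter Topology Asymptotics

/-- The counting function `𝒩(x) = #{n : lam n > x}` of a sequence.  (The set is finite for every
`x > 0` when `lam` tends to zero; `Set.ncard` gives `0` when the set is infinite, so for a positive
sequence such values can never be equivalent to an eventually positive function.) -/
noncomputable def countingFunction (lam : ℕ → ℝ) (x : ℝ) : ℝ :=
  (Set.ncard {n : ℕ | x < lam n} : ℝ)

/-- `φ` is slowly varying at zero (from the right): it is positive near `0`, and
`φ (c t) / φ t → 1` as `t → 0+` for every `c > 0`. -/
def SlowlyVaryingAtZero (φ : ℝ → ℝ) : Prop :=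
  (∀ᶠ t in 𝓝[>] (0 : ℝ), 0 < φ t) ∧
    ∀ c : ℝ, 0 < c → Tendsto (fun t : ℝ => φ (c * t) / φ t) (𝓝[>] 0) (𝓝 1)

/-- The probability `P {∑ lam n * ξ n ^ 2 ≤ r}`; the sum of nonnegative terms is taken
in `[0, ∞]`. -/
noncomputable def smallBallProb {Ω : Type*} [MeasurableSpace Ω] (P : Measure Ω)
    (lam : ℕ → ℝ) (ξ : ℕ → Ω → ℝ) (r : ℝ) : ℝ :=
  P.real {ω | ∑' n, ENNReal.ofReal (lam n * ξ n ω ^ 2) ≤ ENNReal.ofReal r}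

/-! Put x = 1/u(r), N = `countingFunction lam` and S(x) = Σ log(λ_n/x) over the head λ_n > x
(`headLogSum`). Making every head term λ_n ξ_n² of order x has log probability -S(x)/2 up to
O(N(x)), and controlling the tail costs only a constant.

Slow variation gives N = o(S) (`countingFunction_isLittleO_headLogSum`), while the hypothesis on u
says r ~ x N(x)/2. Hence errors of order N(x) or r/x are negligible. Since S(x) - S(1) = ∫_x^1 N(z)
dz/z and S → ∞, also S(x) ~ ∫_x^1 φ(z) dz/z (`integral_div_isEquivalent_headLogSum`).

The upper bound (`smallBallProb_le`) is Chernoff's inequality at exponent -1/x. For the lower bound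
(`exists_le_log_smallBallProb`), each head term is kept below x/8; the independent tail has mean at
most x N(x)/16, so Markov's inequality applies. -/

open Classical in
/-- The indices `n` with `x < lam n` (empty when there are infinitely many). -/
noncomputable def headIndices (lam : ℕ → ℝ) (x : ℝ) : Finset ℕ :=
  if h : {n : ℕ | x < lam n}.Finite then h.toFinset else ∅

/-- The sum of `log (lam n / x)` over the indices with `x < lam n`. -/
noncomputable def headLogSum (lam : ℕ → ℝ) (x : ℝ) : ℝ :=
  ∑ n ∈ headIndices lam x, Real.log (lam n / x)

/-! ### Counting function and slow variation -/

lemma countingFunction_eq_card (lam : ℕ → ℝ) (x : ℝ) :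
    countingFunction lam x = (headIndices lam x).card := by
  unfold countingFunction headIndices
  split_ifs with h
  · rw [Set.ncard_eq_toFinset_card _ h]
  · simp [Set.Infinite.ncard h]

lemma countingFunction_nonneg (lam : ℕ → ℝ) (x : ℝ) : 0 ≤ countingFunction lam x :=
  Nat.cast_nonneg _

/-- `Set.ncard` vanishes on infinite sets, so a positive count at arbitrarily small levels forces
finiteness at every level. -/
lemma finite_setOf_lt_of_eventually_pos {lam : ℕ → ℝ}
    (h : ∀ᶠ x in 𝓝[>] (0 : ℝ), 0 < countingFunction lam x) {x : ℝ} (hx : 0 < x) :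
    {n : ℕ | x < lam n}.Finite := by
  obtain ⟨y, hy, hyx⟩ := (h.and (Ioo_mem_nhdsGT hx)).exists
  have hfin : {n : ℕ | y < lam n}.Finite := by
    by_contra hinf
    simp [countingFunction, Set.Infinite.ncard hinf] at hy
  exact hfin.subset fun n hn => hyx.2.trans hn

section

variable {lam : ℕ → ℝ}

lemma mem_headIndices (hfin : ∀ x : ℝ, 0 < x → {n : ℕ | x < lam n}.Finite) {x : ℝ}
    (hx : 0 < x) {n : ℕ} : n ∈ headIndices lam x ↔ x < lam n := by
  simp [headIndices, hfin x hx]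

lemma headIndices_subset (hfin : ∀ x : ℝ, 0 < x → {n : ℕ | x < lam n}.Finite) {x y : ℝ}
    (hx : 0 < x) (hxy : x ≤ y) : headIndices lam y ⊆ headIndices lam x := by
  intro n hn
  rw [mem_headIndices hfin (hx.trans_le hxy)] at hn
  exact (mem_headIndices hfin hx).2 (hxy.trans_lt hn)

lemma countingFunction_tendsto_atTop (hlam : ∀ n, 0 < lam n)
    (hfin : ∀ x : ℝ, 0 < x → {n : ℕ | x < lam n}.Finite) :
    Tendsto (countingFunction lam) (𝓝[>] 0) atTop := by
  have hk : ∀ k : ℕ, ∀ᶠ x in 𝓝[>] (0 : ℝ), (k : ℝ) ≤ countingFunction lam x := by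
    intro k
    have h1 : ∀ᶠ x in 𝓝[>] (0 : ℝ), ∀ n ∈ Finset.range k, x < lam n := by
      rw [Filter.eventually_all_finset]
      intro n _
      filter_upwards [Ioo_mem_nhdsGT (hlam n)] with x hx using hx.2
    filter_upwards [h1, self_mem_nhdsWithin] with x hx hx0
    rw [countingFunction_eq_card]
    have : Finset.range k ⊆ headIndices lam x := fun n hn => (mem_headIndices hfin hx0).2 (hx n hn)
    simpa using (Nat.cast_le (α := ℝ)).2 (Finset.card_le_card this)
  rw [tendsto_atTop]
  intro b
  obtain ⟨k, hkb⟩ := exists_nat_ge b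
  filter_upwards [hk k] with x hx using hkb.trans hx

lemma tendsto_const_mul_nhdsGT_zero {c : ℝ} (hc : 0 < c) :
    Tendsto (fun t : ℝ => c * t) (𝓝[>] 0) (𝓝[>] 0) := by
  refine tendsto_nhdsWithin_iff.2 ⟨?_, ?_⟩
  · have : Tendsto (fun t : ℝ => c * t) (𝓝 0) (𝓝 (c * 0)) := tendsto_id.const_mul c
    rw [mul_zero] at this
    exact this.mono_left nhdsWithin_le_nhds
  · filter_upwards [self_mem_nhdsWithin] with t ht using mul_pos hc ht

/-- Transfers slow variation from φ to N, which, unlike φ, is monotone and integer valued. -/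
lemma SlowlyVaryingAtZero.of_isEquivalent {φ ψ : ℝ → ℝ} (hφ : SlowlyVaryingAtZero φ)
    (h : ψ ~[𝓝[>] (0 : ℝ)] φ) : SlowlyVaryingAtZero ψ := by
  have hpos := h.eventually_pos hφ.1
  refine ⟨hpos, fun c hc => ?_⟩
  have h1 : (fun t => φ (c * t)) ~[𝓝[>] (0 : ℝ)] φ :=
    (isEquivalent_iff_tendsto_one (hφ.1.mono fun t ht => ht.ne')).2 (hφ.2 c hc)
  have h2 : (fun t => ψ (c * t)) ~[𝓝[>] (0 : ℝ)] (fun t => φ (c * t)) :=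
    h.comp_tendsto (tendsto_const_mul_nhdsGT_zero hc)
  exact (isEquivalent_iff_tendsto_one (hpos.mono fun t ht => ht.ne')).1 ((h2.trans h1).trans h.symm)

lemma SlowlyVaryingAtZero.eventually_le_mul {ψ : ℝ → ℝ} (hψ : SlowlyVaryingAtZero ψ) {c a : ℝ}
    (hc : 0 < c) (ha : 1 < a) : ∀ᶠ t in 𝓝[>] (0 : ℝ), ψ (c * t) ≤ a * ψ t := by
  filter_upwards [hψ.1, (hψ.2 c hc).eventually_lt_const ha] with t ht h
  rw [div_lt_iff₀ ht] at h
  exact h.le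

lemma SlowlyVaryingAtZero.eventually_mul_le {ψ : ℝ → ℝ} (hψ : SlowlyVaryingAtZero ψ) {c a : ℝ}
    (hc : 0 < c) (ha : a < 1) : ∀ᶠ t in 𝓝[>] (0 : ℝ), a * ψ t ≤ ψ (c * t) := by
  filter_upwards [hψ.1, (hψ.2 c hc).eventually_const_lt ha] with t ht h
  rw [lt_div_iff₀ ht] at h
  exact h.le

/-! ### The logarithmic head sum and its integral form -/

lemma headLogSum_nonneg (hfin : ∀ x : ℝ, 0 < x → {n : ℕ | x < lam n}.Finite) {x : ℝ}
    (hx : 0 < x) : 0 ≤ headLogSum lam x := by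
  refine Finset.sum_nonneg fun n hn => Real.log_nonneg ?_
  rw [mem_headIndices hfin hx] at hn
  rw [le_div_iff₀ hx]
  linarith

/-- Each index with λ_n > Kx contributes at least log K; the other head terms are nonnegative. -/
lemma log_mul_countingFunction_le (hfin : ∀ x : ℝ, 0 < x → {n : ℕ | x < lam n}.Finite)
    {x K : ℝ} (hx : 0 < x) (hK : 1 ≤ K) :
    Real.log K * countingFunction lam (K * x) ≤ headLogSum lam x := by
  have hKx : x ≤ K * x := le_mul_of_one_le_left hx.le hK
  rw [countingFunction_eq_card, mul_comm, ← nsmul_eq_mul]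
  refine (Finset.card_nsmul_le_sum _ (fun n => Real.log (lam n / x)) _ fun n hn => ?_).trans
    (Finset.sum_le_sum_of_subset_of_nonneg (headIndices_subset hfin hx hKx) fun n hn _ => ?_)
  · rw [mem_headIndices hfin (hx.trans_le hKx)] at hn
    apply Real.log_le_log (by linarith)
    rw [le_div_iff₀ hx]
    exact hn.le
  · rw [mem_headIndices hfin hx] at hn
    apply Real.log_nonneg
    rw [le_div_iff₀ hx]
    linarith

lemma countingFunction_isLittleO_headLogSum
    (hfin : ∀ x : ℝ, 0 < x → {n : ℕ | x < lam n}.Finite)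
    (hsv : SlowlyVaryingAtZero (countingFunction lam)) :
    countingFunction lam =o[𝓝[>] (0 : ℝ)] headLogSum lam := by
  rw [isLittleO_iff]
  intro ε hε
  -- With K = exp(2/ε), log K = 2/ε compensates both ε and the factor 1/2 lost in N(Kx) ≥ N(x)/2.
  have hK : 1 ≤ Real.exp (2 / ε) := Real.one_le_exp (by positivity)
  filter_upwards [self_mem_nhdsWithin,
    hsv.eventually_mul_le (Real.exp_pos (2 / ε)) (show (1 / 2 : ℝ) < 1 by norm_num)] with x hx hx2
  have h := log_mul_countingFunction_le hfin hx hK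
  rw [Real.log_exp] at h
  rw [Real.norm_of_nonneg (countingFunction_nonneg _ _),
    Real.norm_of_nonneg (headLogSum_nonneg hfin hx)]
  have h3 : 2 / ε * (1 / 2 * countingFunction lam x) ≤ headLogSum lam x :=
    (mul_le_mul_of_nonneg_left hx2 (by positivity)).trans h
  calc countingFunction lam x = ε * (2 / ε * (1 / 2 * countingFunction lam x)) := by field_simp
    _ ≤ _ := by gcongr

lemma headLogSum_tendsto_atTop (hlam : ∀ n, 0 < lam n)
    (hfin : ∀ x : ℝ, 0 < x → {n : ℕ | x < lam n}.Finite)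
    (hsv : SlowlyVaryingAtZero (countingFunction lam)) :
    Tendsto (headLogSum lam) (𝓝[>] 0) atTop := by
  refine tendsto_atTop_mono' _ ?_ (countingFunction_tendsto_atTop hlam hfin)
  have h := (countingFunction_isLittleO_headLogSum hfin hsv).bound (c := 1) one_pos
  filter_upwards [h, self_mem_nhdsWithin] with x hx hx0
  rwa [Real.norm_of_nonneg (countingFunction_nonneg _ _),
    Real.norm_of_nonneg (headLogSum_nonneg hfin hx0), one_mul] at hx

lemma intervalIntegrable_indicator_div {a b l : ℝ} (ha : 0 < a) (hab : a ≤ b) :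
    IntervalIntegrable (fun z => (Set.Iio l).indicator (fun _ => (1 : ℝ)) z / z) volume a b := by
  have h1 : IntervalIntegrable (fun z : ℝ => 1 / z) volume a b := by
    apply intervalIntegral.intervalIntegrable_one_div
    · intro z hz
      rw [Set.uIcc_of_le hab] at hz
      exact (ha.trans_le hz.1).ne'
    · exact continuousOn_id
  have : (fun z => (Set.Iio l).indicator (fun _ => (1 : ℝ)) z / z) =
      (Set.Iio l).indicator (fun z : ℝ => 1 / z) := by
    ext z
    by_cases hz : z < l <;> simp [Set.indicator, hz]
  rw [this]
  rw [intervalIntegrable_iff] at h1 ⊢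
  exact h1.indicator measurableSet_Iio

/-- The subtracted term corrects for l > 1, since the integral stops at 1; summed over n, these
terms form S(1). -/
lemma integral_indicator_div {a l : ℝ} (ha : 0 < a) (ha1 : a ≤ 1) (hal : a < l) :
    ∫ z in a..1, (Set.Iio l).indicator (fun _ => (1 : ℝ)) z / z =
      Real.log (l / a) - if 1 < l then Real.log (l / 1) else 0 := by
  have hl : 0 < l := ha.trans hal
  split_ifs with h
  · have : ∫ z in a..1, (Set.Iio l).indicator (fun _ => (1 : ℝ)) z / z = ∫ z in a..1, 1 / z := by
      refine intervalIntegral.integral_congr fun z hz => ?_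
      rw [Set.uIcc_of_le ha1] at hz
      simp [Set.indicator, hz.2.trans_lt h]
    rw [this, integral_one_div_of_pos ha one_pos, ← Real.log_div (by positivity) (by positivity)]
    congr 1
    field_simp
  · have hl1 : l ≤ 1 := not_lt.1 h
    rw [← intervalIntegral.integral_add_adjacent_intervals
      (intervalIntegrable_indicator_div ha hal.le) (intervalIntegrable_indicator_div hl hl1)]
    have h1 : ∫ z in a..l, (Set.Iio l).indicator (fun _ => (1 : ℝ)) z / z = ∫ z in a..l, 1 / z := by
      refine intervalIntegral.integral_congr_ae ?_
      have hne : ∀ᵐ z : ℝ, z ≠ l := by simp [ae_iff]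
      filter_upwards [hne] with z hzl hz
      rw [Set.uIoc_of_le hal.le] at hz
      simp [Set.indicator, lt_of_le_of_ne hz.2 hzl]
    have h2 : ∫ z in l..1, (Set.Iio l).indicator (fun _ => (1 : ℝ)) z / z = ∫ z in l..1, 0 := by
      refine intervalIntegral.integral_congr fun z hz => ?_
      rw [Set.uIcc_of_le hl1] at hz
      simp [Set.indicator, not_lt.2 hz.1]
    rw [h1, h2, integral_one_div_of_pos ha hl]
    simp

lemma countingFunction_eq_sum_indicator (hfin : ∀ x : ℝ, 0 < x → {n : ℕ | x < lam n}.Finite)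
    {x z : ℝ} (hx : 0 < x) (hxz : x ≤ z) :
    countingFunction lam z =
      ∑ n ∈ headIndices lam x, (Set.Iio (lam n)).indicator (fun _ => (1 : ℝ)) z := by
  classical
  rw [countingFunction_eq_card]
  simp only [Set.indicator, Set.mem_Iio]
  rw [Finset.sum_boole]
  congr 2
  ext n
  rw [Finset.mem_filter, mem_headIndices hfin (hx.trans_le hxz), mem_headIndices hfin hx]
  exact ⟨fun h => ⟨hxz.trans_lt h, h⟩, fun h => h.2⟩

lemma intervalIntegrable_countingFunction_div
    (hfin : ∀ x : ℝ, 0 < x → {n : ℕ | x < lam n}.Finite) {a b : ℝ} (ha : 0 < a) (hab : a ≤ b) :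
    IntervalIntegrable (fun z => countingFunction lam z / z) volume a b := by
  have h : IntervalIntegrable (fun z => ∑ n ∈ headIndices lam a,
      (Set.Iio (lam n)).indicator (fun _ => (1 : ℝ)) z / z) volume a b := by
    have := IntervalIntegrable.sum (headIndices lam a) (μ := volume) (a := a) (b := b)
      (f := fun n z => (Set.Iio (lam n)).indicator (fun _ => (1 : ℝ)) z / z)
      fun n _ => intervalIntegrable_indicator_div ha hab
    rwa [Finset.sum_fn] at this
  refine h.congr fun z hz => ?_
  rw [Set.uIoc_of_le hab] at hz
  rw [← Finset.sum_div, countingFunction_eq_sum_indicator hfin ha hz.1.le]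

/-- Layer cake: on [x, 1], N is a finite sum of indicators of λ_n > z, integrated term by term. -/
lemma integral_countingFunction_div (hfin : ∀ x : ℝ, 0 < x → {n : ℕ | x < lam n}.Finite)
    {x : ℝ} (hx : 0 < x) (hx1 : x ≤ 1) :
    ∫ z in x..1, countingFunction lam z / z = headLogSum lam x - headLogSum lam 1 := by
  have h : ∫ z in x..1, countingFunction lam z / z = ∫ z in x..1, ∑ n ∈ headIndices lam x,
      (Set.Iio (lam n)).indicator (fun _ => (1 : ℝ)) z / z := by
    refine intervalIntegral.integral_congr fun z hz => ?_
    rw [Set.uIcc_of_le hx1] at hz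
    rw [← Finset.sum_div, countingFunction_eq_sum_indicator hfin hx hz.1]
  rw [h, intervalIntegral.integral_finsetSum
    fun n _ => intervalIntegrable_indicator_div hx hx1]
  rw [Finset.sum_congr rfl fun n hn =>
    integral_indicator_div hx hx1 ((mem_headIndices hfin hx).1 hn), Finset.sum_sub_distrib,
    ← Finset.sum_filter]
  congr 1
  refine Finset.sum_congr ?_ fun _ _ => rfl
  ext n
  rw [Finset.mem_filter, mem_headIndices hfin one_pos, mem_headIndices hfin hx]
  exact ⟨fun h => h.2, fun h => ⟨hx1.trans_lt h, h⟩⟩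

lemma intervalIntegrable_div_of_integrableOn {φ : ℝ → ℝ}
    (hφint : ∀ x : ℝ, 0 < x → IntegrableOn φ (Set.Icc x 1) volume) {a b : ℝ} (ha : 0 < a)
    (hab : a ≤ b) (hb : b ≤ 1) : IntervalIntegrable (fun z => φ z / z) volume a b := by
  have h : IntegrableOn φ (Set.Icc a b) volume := (hφint a ha).mono_set (Set.Icc_subset_Icc_right hb)
  rw [intervalIntegrable_iff_integrableOn_Icc_of_le hab]
  have h2 : ContinuousOn (fun z : ℝ => z⁻¹) (Set.Icc a b) :=
    continuousOn_inv₀.mono fun z hz => (ha.trans_le hz.1).ne'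
  simpa only [div_eq_mul_inv] using h.mul_continuousOn h2 isCompact_Icc

/-- Near zero |φ - N| ≤ (ε/2) N, which integrates to at most (ε/2) S. The integral away from zero is
a constant, absorbed because S → ∞. -/
lemma integral_div_isEquivalent_headLogSum (hlam : ∀ n, 0 < lam n) {φ : ℝ → ℝ}
    (hfin : ∀ x : ℝ, 0 < x → {n : ℕ | x < lam n}.Finite)
    (hsv : SlowlyVaryingAtZero (countingFunction lam))
    (hφint : ∀ x : ℝ, 0 < x → IntegrableOn φ (Set.Icc x 1) volume)
    (hN : φ ~[𝓝[>] (0 : ℝ)] countingFunction lam) :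
    (fun x => ∫ z in x..1, φ z / z) ~[𝓝[>] (0 : ℝ)] headLogSum lam := by
  have hS := headLogSum_tendsto_atTop hlam hfin hsv
  have key : (fun x => ∫ z in x..1, (φ z / z - countingFunction lam z / z)) =o[𝓝[>] (0 : ℝ)]
      headLogSum lam := by
    rw [isLittleO_iff]
    intro ε hε
    have hb := hN.isLittleO.bound (half_pos hε)
    obtain ⟨t, ht, hbt⟩ := (mem_nhdsGT_iff_exists_Ioo_subset' (one_pos : (0 : ℝ) < 1)).1
      (inter_mem hb (Ioo_mem_nhdsGT (one_pos : (0 : ℝ) < 1)))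
    have ht0 : (0 : ℝ) < t := ht
    -- Halving t puts the splitting point s itself inside the open interval of validity.
    set s := t / 2 with hs
    have hs0 : 0 < s := by positivity
    have hs1 : s ≤ 1 := (hbt ⟨hs0, by linarith⟩).2.2.le
    set C := ‖∫ z in s..1, (φ z / z - countingFunction lam z / z)‖
    filter_upwards [Ioo_mem_nhdsGT hs0, hS.eventually_ge_atTop (C / (ε / 2))] with x hx hxC
    rw [div_le_iff₀ (half_pos hε)] at hxC
    have hx1 : x ≤ 1 := hx.2.le.trans hs1
    have hN1 := intervalIntegrable_countingFunction_div hfin hx.1 hx.2.le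
    have hN2 := intervalIntegrable_countingFunction_div hfin hs0 hs1
    have i1 := (intervalIntegrable_div_of_integrableOn hφint hx.1 hx.2.le hs1).sub hN1
    have i2 := (intervalIntegrable_div_of_integrableOn hφint hs0 hs1 le_rfl).sub hN2
    have e := intervalIntegral.integral_add_adjacent_intervals i1 i2
    have b1 : ‖∫ z in x..s, (φ z / z - countingFunction lam z / z)‖ ≤
        ∫ z in x..s, ε / 2 * (countingFunction lam z / z) := by
      refine intervalIntegral.norm_integral_le_of_norm_le hx.2.le
        (ae_of_all _ fun z hz => ?_) (hN1.const_mul _)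
      have hz0 : 0 < z := hx.1.trans hz.1
      have := (hbt ⟨hz0, by linarith [hz.2]⟩ : z ∈ _).1
      simp only [Set.mem_ofPred_eq, Pi.sub_apply] at this
      rw [Real.norm_of_nonneg (countingFunction_nonneg _ _)] at this
      rw [← sub_div, norm_div, Real.norm_of_nonneg hz0.le, ← mul_div_assoc]
      gcongr
    have b2 : ∫ z in x..s, countingFunction lam z / z ≤ headLogSum lam x := by
      have h3 : 0 ≤ ∫ z in s..1, countingFunction lam z / z :=
        intervalIntegral.integral_nonneg hs1 fun z hz =>
          div_nonneg (countingFunction_nonneg _ _) (hs0.le.trans hz.1)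
      have h4 := intervalIntegral.integral_add_adjacent_intervals hN1 hN2
      rw [integral_countingFunction_div hfin hx.1 hx1] at h4
      linarith [headLogSum_nonneg hfin (lam := lam) one_pos]
    rw [intervalIntegral.integral_const_mul] at b1
    rw [Real.norm_of_nonneg (headLogSum_nonneg hfin hx.1)]
    calc ‖∫ z in x..1, (φ z / z - countingFunction lam z / z)‖
        ≤ ‖∫ z in x..s, (φ z / z - countingFunction lam z / z)‖ + C := by
          rw [← e]; exact norm_add_le _ _
      _ ≤ ε / 2 * headLogSum lam x + headLogSum lam x * (ε / 2) :=
          add_le_add (b1.trans (mul_le_mul_of_nonneg_left b2 (half_pos hε).le)) hxC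
      _ = ε * headLogSum lam x := by ring
  have hconst : (fun _ : ℝ => headLogSum lam 1) =o[𝓝[>] (0 : ℝ)] headLogSum lam :=
    isLittleO_const_left.2 (Or.inr (tendsto_norm_atTop_atTop.comp hS))
  refine IsLittleO.congr' (key.sub hconst) ?_ EventuallyEq.rfl
  filter_upwards [Ioo_mem_nhdsGT (one_pos : (0 : ℝ) < 1)] with x hx
  rw [intervalIntegral.integral_sub
    (intervalIntegrable_div_of_integrableOn hφint hx.1 hx.2.le le_rfl)
    (intervalIntegrable_countingFunction_div hfin hx.1 hx.2.le),
    integral_countingFunction_div hfin hx.1 hx.2.le]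
  simp only [Pi.sub_apply]
  ring

/-! ### Dyadic bound for the tail sum -/

-- Cut the tail at the levels y_k = x/2^k. At most δ(1+δ)^k N(x) indices lie between y_{k+1} and
-- y_k, each with λ_n ≤ y_k, giving a geometric series of ratio (1+δ)/2.
open scoped Classical in
lemma tsum_tail_le (hfin : ∀ x : ℝ, 0 < x → {n : ℕ | x < lam n}.Finite)
    (hlam : ∀ n, 0 < lam n) {x t δ : ℝ} (hx : 0 < x) (hxt : x < t) (hδ : 0 < δ) (hδ1 : δ < 1)
    (h : ∀ y ∈ Set.Ioo 0 t, countingFunction lam (1 / 2 * y) ≤ (1 + δ) * countingFunction lam y) :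
    ∑' n, ENNReal.ofReal (if n ∈ headIndices lam x then 0 else lam n) ≤
      ENNReal.ofReal (x * (δ * countingFunction lam x) * (2 / (1 - δ))) := by
  set y : ℕ → ℝ := fun k => x * (1 / 2) ^ k with hy
  have hy0 : ∀ k, 0 < y k := fun k => by positivity
  have hyx : ∀ k, y k ≤ x := fun k =>
    mul_le_of_le_one_right hx.le (pow_le_one₀ (by norm_num) (by norm_num))
  have hys : ∀ k, y (k + 1) = 1 / 2 * y k := fun k => by simp only [hy, pow_succ]; ring
  have hstep : ∀ k, countingFunction lam (y (k + 1)) ≤ (1 + δ) * countingFunction lam (y k) :=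
    fun k => hys k ▸ h _ ⟨hy0 k, (hyx k).trans_lt hxt⟩
  have hpow : ∀ k, countingFunction lam (y k) ≤ (1 + δ) ^ k * countingFunction lam x := by
    intro k
    induction k with
    | zero => simp [hy]
    | succ k ih =>
      refine (hstep k).trans ?_
      rw [pow_succ']
      rw [mul_assoc]
      gcongr
  have hcard : ∀ k, ((headIndices lam (y (k + 1)) \ headIndices lam (y k)).card : ℝ) ≤
      δ * ((1 + δ) ^ k * countingFunction lam x) := by
    intro k
    have hsub := headIndices_subset hfin (hy0 (k + 1))
      (show y (k + 1) ≤ y k by rw [hys]; linarith [hy0 k])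
    rw [Finset.card_sdiff_of_subset hsub, Nat.cast_sub (Finset.card_le_card hsub),
      ← countingFunction_eq_card, ← countingFunction_eq_card]
    calc _ ≤ δ * countingFunction lam (y k) := by linarith [hstep k]
      _ ≤ _ := by gcongr; exact hpow k
  have hterm : ∀ n, ENNReal.ofReal (if n ∈ headIndices lam x then 0 else lam n) ≤
      ∑' k, if n ∈ headIndices lam (y (k + 1)) \ headIndices lam (y k)
        then ENNReal.ofReal (y k) else 0 := by
    intro n
    split_ifs with hn
    · simp
    have hex : ∃ k, n ∈ headIndices lam (y k) := by
      obtain ⟨k, hk⟩ := exists_pow_lt_of_lt_one (div_pos (hlam n) hx)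
        (show (1 / 2 : ℝ) < 1 by norm_num)
      refine ⟨k, (mem_headIndices hfin (hy0 k)).2 ?_⟩
      rw [lt_div_iff₀ hx] at hk
      simpa only [hy, mul_comm] using hk
    -- The first level whose head contains n is not y_0 = x, so n lies in a genuine dyadic shell.
    have hk0 : Nat.find hex ≠ 0 := fun h0 => hn (by
      have := Nat.find_spec hex
      rw [h0] at this
      simpa [hy] using this)
    obtain ⟨k, hk⟩ := Nat.exists_eq_succ_of_ne_zero hk0
    have h1 : n ∈ headIndices lam (y (k + 1)) := by
      have := Nat.find_spec hex
      rwa [hk] at this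
    have h2 : n ∉ headIndices lam (y k) := Nat.find_min hex (by omega)
    refine le_trans ?_ (ENNReal.le_tsum k)
    rw [if_pos (Finset.mem_sdiff.2 ⟨h1, h2⟩)]
    rw [mem_headIndices hfin (hy0 k), not_lt] at h2
    exact ENNReal.ofReal_le_ofReal h2
  refine (ENNReal.tsum_le_tsum hterm).trans ?_
  rw [ENNReal.tsum_comm]
  have hNx := countingFunction_nonneg lam x
  have hgeo : HasSum (fun k => x * (δ * countingFunction lam x) * ((1 + δ) / 2) ^ k)
      (x * (δ * countingFunction lam x) * (2 / (1 - δ))) := by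
    have := (hasSum_geometric_of_lt_one (show 0 ≤ (1 + δ) / 2 by linarith)
      (show (1 + δ) / 2 < 1 by linarith)).mul_left (x * (δ * countingFunction lam x))
    rwa [show 1 - (1 + δ) / 2 = (1 - δ) / 2 by ring, inv_div] at this
  rw [← hgeo.tsum_eq, ENNReal.ofReal_tsum_of_nonneg (fun k => by positivity) hgeo.summable]
  refine ENNReal.tsum_le_tsum fun k => ?_
  rw [tsum_eq_sum (s := headIndices lam (y (k + 1)) \ headIndices lam (y k))
    fun n hn => if_neg hn, Finset.sum_congr rfl fun n hn => if_pos hn, Finset.sum_const,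
    nsmul_eq_mul, ← ENNReal.ofReal_natCast, ← ENNReal.ofReal_mul (Nat.cast_nonneg _)]
  refine ENNReal.ofReal_le_ofReal ?_
  calc _ ≤ δ * ((1 + δ) ^ k * countingFunction lam x) * y k :=
        mul_le_mul_of_nonneg_right (hcard k) (hy0 k).le
    _ = _ := by simp only [hy, div_pow, one_pow]; ring

open scoped Classical in
lemma eventually_tsum_tail_le (hlam : ∀ n, 0 < lam n)
    (hfin : ∀ x : ℝ, 0 < x → {n : ℕ | x < lam n}.Finite)
    (hsv : SlowlyVaryingAtZero (countingFunction lam)) :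
    ∀ᶠ x in 𝓝[>] (0 : ℝ), ∑' n, ENNReal.ofReal (if n ∈ headIndices lam x then 0 else lam n) ≤
      ENNReal.ofReal (x * countingFunction lam x / 16) := by
  -- For δ = 1/40 the factor 2δ/(1-δ) equals 2/39, below 1/16.
  have h := hsv.eventually_le_mul (c := 1 / 2) (a := 1 + 1 / 40) (by norm_num) (by norm_num)
  obtain ⟨t, ht, hbt⟩ := (mem_nhdsGT_iff_exists_Ioo_subset' (one_pos : (0 : ℝ) < 1)).1 h
  filter_upwards [Ioo_mem_nhdsGT (show (0 : ℝ) < t from ht)] with x hx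
  refine (tsum_tail_le hfin hlam hx.1 hx.2 (δ := 1 / 40) (by norm_num) (by norm_num)
    fun y hy => hbt hy).trans (ENNReal.ofReal_le_ofReal ?_)
  have := mul_nonneg hx.1.le (countingFunction_nonneg lam x)
  linarith

end

/-! ### Standard Gaussian estimates -/

/-- On [-s, s] with s ≤ 1 the density is at least its value at 1. -/
lemma exists_mul_le_gaussianReal_Icc :
    ∃ c : ℝ, 0 < c ∧ ∀ s ∈ Set.Icc (0 : ℝ) 1,
      ENNReal.ofReal (c * s) ≤ gaussianReal 0 1 (Set.Icc (-s) s) := by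
  refine ⟨2 * gaussianPDFReal 0 1 1, mul_pos two_pos (gaussianPDFReal_pos _ _ _ one_ne_zero), ?_⟩
  intro s hs
  rw [gaussianReal_apply 0 one_ne_zero]
  calc ENNReal.ofReal (2 * gaussianPDFReal 0 1 1 * s)
      = ∫⁻ _ in Set.Icc (-s) s, ENNReal.ofReal (gaussianPDFReal 0 1 1) := by
        rw [setLIntegral_const, Real.volume_Icc,
          ← ENNReal.ofReal_mul (gaussianPDFReal_nonneg _ _ _)]
        congr 1
        ring
    _ ≤ _ := by
        refine setLIntegral_mono (measurable_gaussianPDF _ _) fun x hx => ?_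
        refine ENNReal.ofReal_le_ofReal ?_
        have hx2 : x ^ 2 ≤ 1 := by
          rw [sq_le_one_iff_abs_le_one, abs_le]
          exact ⟨by linarith [hx.1, hs.2], hx.2.trans hs.2⟩
        simp only [gaussianPDFReal_def]
        gcongr _ * Real.exp (-?_ / _)
        simpa using hx2

lemma integral_exp_neg_mul_sq_gaussianReal {a : ℝ} (ha : 0 ≤ a) :
    ∫ x, Real.exp (-a * x ^ 2) ∂(gaussianReal 0 1) = (√(1 + 2 * a))⁻¹ := by
  rw [integral_gaussianReal_eq_integral_smul one_ne_zero]
  have h : ∀ x : ℝ, gaussianPDFReal 0 1 x • Real.exp (-a * x ^ 2) =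
      (√(2 * Real.pi))⁻¹ * Real.exp (-(a + 1 / 2) * x ^ 2) := by
    intro x
    simp only [gaussianPDFReal_def, smul_eq_mul, NNReal.coe_one, mul_one, sub_zero]
    rw [mul_assoc, ← Real.exp_add]
    congr 2
    ring
  simp_rw [h]
  rw [integral_const_mul, integral_gaussian, ← Real.sqrt_inv, ← Real.sqrt_inv, ← Real.sqrt_mul (by positivity)]
  congr 1
  have := Real.pi_pos
  field_simp
  ring

/-! ### Upper and lower small ball bounds -/

section

variable {Ω : Type*} [MeasurableSpace Ω] {P : Measure Ω}
  {ξ : ℕ → Ω → ℝ} {lam : ℕ → ℝ}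

lemma smallBallProb_congr {ξ' : ℕ → Ω → ℝ} (h : ∀ n, ξ n =ᵐ[P] ξ' n) (r : ℝ) :
    smallBallProb P lam ξ r = smallBallProb P lam ξ' r := by
  refine measureReal_congr ?_
  filter_upwards [ae_all_iff.2 h] with ω hω
  have : (∑' n, ENNReal.ofReal (lam n * ξ n ω ^ 2)) = ∑' n, ENNReal.ofReal (lam n * ξ' n ω ^ 2) :=
    tsum_congr fun n => by rw [hω n]
  exact congrArg (· ≤ ENNReal.ofReal r) this

/-- Chernoff's inequality at exponent -1/x after dropping the tail; each factor (1 + 2λ_n/x)^(-1/2)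
is at most (λ_n/x)^(-1/2). -/
lemma smallBallProb_le [IsProbabilityMeasure P] (hξ : ∀ n, HasLaw (ξ n) (gaussianReal 0 1) P) (hindep : iIndepFun ξ P)
    (hlam : ∀ n, 0 < lam n) {r x : ℝ} (hr : 0 ≤ r) (hx : 0 < x) :
    smallBallProb P lam ξ r ≤ Real.exp (r / x - headLogSum lam x / 2) := by
  set H := headIndices lam x
  set X : ℕ → Ω → ℝ := fun n ω => lam n * ξ n ω ^ 2 with hX
  have hXm : ∀ n, AEMeasurable (X n) P := fun n =>
    ((hξ n).aemeasurable.pow_const 2).const_mul _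
  have hXind : iIndepFun X P :=
    hindep.comp (fun n y => lam n * y ^ 2) (fun n => by fun_prop)
  have hsub : smallBallProb P lam ξ r ≤ P.real {ω | (∑ n ∈ H, X n) ω ≤ r} := by
    refine measureReal_mono fun ω hω => ?_
    have h1 := (ENNReal.sum_le_tsum H).trans (show _ ≤ _ from hω)
    rw [← ENNReal.ofReal_sum_of_nonneg
      fun n _ => mul_nonneg (hlam n).le (sq_nonneg _), ENNReal.ofReal_le_ofReal_iff hr] at h1
    simpa [hX] using h1
  have hmgf : ∀ n, mgf (X n) P (-x⁻¹) = (√(1 + 2 * (x⁻¹ * lam n)))⁻¹ := by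
    intro n
    have ha : 0 ≤ x⁻¹ * lam n := mul_nonneg (inv_nonneg.2 hx.le) (hlam n).le
    rw [← integral_exp_neg_mul_sq_gaussianReal ha,
      ← (hξ n).integral_comp (by fun_prop)]
    refine integral_congr_ae (ae_of_all _ fun ω => ?_)
    simp only [hX, Function.comp]
    congr 1
    ring
  have hint : Integrable (fun ω => Real.exp (-x⁻¹ * (∑ n ∈ H, X n) ω)) P := by
    refine Integrable.of_bound (C := 1) ?_ (ae_of_all _ fun ω => ?_)
    · exact (Real.measurable_exp.comp_aemeasurable
        ((Finset.aemeasurable_sum H fun n _ => hXm n).const_mul _)).aestronglyMeasurable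
    · rw [Real.norm_of_nonneg (Real.exp_pos _).le, Real.exp_le_one_iff, neg_mul, neg_nonpos,
        Finset.sum_apply]
      exact mul_nonneg (inv_nonneg.2 hx.le)
        (Finset.sum_nonneg fun n _ => mul_nonneg (hlam n).le (sq_nonneg _))
  refine hsub.trans ((measure_le_le_exp_mul_mgf r
    (neg_nonpos.2 (inv_nonneg.2 hx.le)) hint).trans ?_)
  rw [hXind.mgf_sum₀ hXm, sub_eq_add_neg, Real.exp_add, neg_neg, div_eq_inv_mul, headLogSum,
    Finset.sum_div, ← Finset.sum_neg_distrib, Real.exp_sum]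
  refine mul_le_mul_of_nonneg_left (Finset.prod_le_prod (fun n _ => mgf_nonneg) fun n _ => ?_)
    (Real.exp_pos _).le
  have hq : 0 < lam n / x := div_pos (hlam n) hx
  rw [hmgf, Real.exp_neg, ← Real.log_sqrt hq.le, Real.exp_log (Real.sqrt_pos.2 hq)]
  have : lam n / x ≤ 1 + 2 * (x⁻¹ * lam n) := by
    rw [div_eq_inv_mul] at hq ⊢
    linarith
  have hs := Real.sqrt_pos.2 hq
  gcongr

-- Since E ξ_n² = 1, the tail has mean at most r/4, and Markov's inequality at level r/2 loses at
-- most one half.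
open scoped Classical in
lemma half_le_measure_tail [IsProbabilityMeasure P] (hξ : ∀ n, HasLaw (ξ n) (gaussianReal 0 1) P)
    (hm : ∀ n, Measurable (ξ n)) (hlam : ∀ n, 0 < lam n) {r x : ℝ} (hr : 0 < r)
    (ht : ∑' n, ENNReal.ofReal (if n ∈ headIndices lam x then 0 else lam n) ≤
      ENNReal.ofReal (r / 4)) :
    2⁻¹ ≤ P {ω | ∑' n, ENNReal.ofReal ((if n ∈ headIndices lam x then 0 else lam n) * ξ n ω ^ 2) ≤
      ENNReal.ofReal (r / 2)} := by
  set a : ℕ → ℝ := fun n => if n ∈ headIndices lam x then 0 else lam n with ha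
  have ha0 : ∀ n, 0 ≤ a n := fun n => by
    simp only [ha]
    split_ifs
    exacts [le_rfl, (hlam n).le]
  set T : Ω → ENNReal := fun ω => ∑' n, ENNReal.ofReal (a n * ξ n ω ^ 2) with hT
  have hTm : Measurable T := Measurable.tsum fun n => by
    have := hm n
    fun_prop
  have hsq : ∀ n, ∫⁻ ω, ENNReal.ofReal (ξ n ω ^ 2) ∂P = 1 := by
    intro n
    rw [(hξ n).lintegral_comp (f := fun y => ENNReal.ofReal (y ^ 2)) (by fun_prop),
      ← ofReal_integral_eq_lintegral_ofReal _ (ae_of_all _ fun y => sq_nonneg y)]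
    · have h := variance_id_gaussianReal (μ := 0) (v := 1)
      rw [variance_eq_integral aemeasurable_id] at h
      simp only [id_eq, integral_id_gaussianReal, sub_zero, NNReal.coe_one] at h
      rw [h, ENNReal.ofReal_one]
    · exact (memLp_id_gaussianReal 2).integrable_sq
  have hTint : ∫⁻ ω, T ω ∂P ≤ ENNReal.ofReal (r / 4) := by
    rw [hT, lintegral_tsum fun n => by have := hm n; fun_prop]
    refine le_trans (le_of_eq (tsum_congr fun n => ?_)) ht
    simp_rw [ENNReal.ofReal_mul (ha0 n)]
    rw [lintegral_const_mul _ (by have := hm n; fun_prop), hsq, mul_one]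
  have hmark := mul_meas_ge_le_lintegral hTm (ENNReal.ofReal (r / 2)) (μ := P)
  have hbad : P {ω | ENNReal.ofReal (r / 2) ≤ T ω} ≤ 2⁻¹ := by
    have h1 := hmark.trans hTint
    have h2 : ENNReal.ofReal (r / 4) = ENNReal.ofReal (r / 2) * 2⁻¹ := by
      rw [show r / 4 = r / 2 * 2⁻¹ by ring, ENNReal.ofReal_mul (by positivity),
        ENNReal.ofReal_inv_of_pos two_pos]
      simp
    rw [h2] at h1
    exact (ENNReal.mul_le_mul_iff_right (by positivity) ENNReal.ofReal_ne_top).1 h1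
  have hms : MeasurableSet {ω | ENNReal.ofReal (r / 2) ≤ T ω} := measurableSet_le measurable_const hTm
  calc (2⁻¹ : ENNReal) = 1 - 2⁻¹ := ENNReal.one_sub_inv_two.symm
    _ ≤ 1 - P {ω | ENNReal.ofReal (r / 2) ≤ T ω} := tsub_le_tsub_left hbad _
    _ = P {ω | ENNReal.ofReal (r / 2) ≤ T ω}ᶜ := (prob_compl_eq_one_sub hms).symm
    _ ≤ _ := measure_mono fun ω hω => le_of_not_ge (show ¬ ENNReal.ofReal (r / 2) ≤ T ω from hω)

-- Head and tail each get a budget r/2: the N(x) head terms are at most x/8 each on the chosen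
-- intervals.
open scoped Classical in
lemma measure_head_mul_measure_tail_le (hm : ∀ n, Measurable (ξ n)) (hindep : iIndepFun ξ P)
    (hlam : ∀ n, 0 < lam n) {r x : ℝ} (hx : 0 < x)
    (hxr : x * countingFunction lam x / 8 ≤ r / 2) :
    (∏ n ∈ headIndices lam x, P (ξ n ⁻¹' Set.Icc (-√(x / (8 * lam n))) (√(x / (8 * lam n))))) *
      P {ω | ∑' n, ENNReal.ofReal ((if n ∈ headIndices lam x then 0 else lam n) * ξ n ω ^ 2) ≤
        ENNReal.ofReal (r / 2)} ≤
      P {ω | ∑' n, ENNReal.ofReal (lam n * ξ n ω ^ 2) ≤ ENNReal.ofReal r} := by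
  set H := headIndices lam x with hH
  set J : ℕ → Set ℝ := fun n => Set.Icc (-√(x / (8 * lam n))) (√(x / (8 * lam n))) with hJ
  set T : Ω → ENNReal :=
    fun ω => ∑' n, ENNReal.ofReal ((if n ∈ H then 0 else lam n) * ξ n ω ^ 2) with hT
  set m : ℕ → MeasurableSpace Ω := fun n => MeasurableSpace.comap (ξ n) inferInstance with hmdef
  rw [← hindep.measure_inter_preimage_eq_mul H (sets := J) fun n _ => measurableSet_Icc]
  -- The σ-algebras generated by the coordinates inside and outside H are independent; the two
  -- events must then be measurable for these.
  have hI := indep_iSup_of_disjoint (m := m) (fun n => (hm n).comap_le) hindep.iIndep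
    (S := {n | n ∈ H}) (T := {n | n ∉ H}) (Set.disjoint_left.2 fun n h1 h2 => h2 h1)
  rw [Indep_iff] at hI
  rw [← hI]
  · refine measure_mono fun ω hω => ?_
    have h1 : ∀ n ∈ H, lam n * ξ n ω ^ 2 ≤ x / 8 := by
      intro n hn
      have h2 : ξ n ω ∈ J n := Set.mem_iInter₂.1 hω.1 n hn
      have h3 : ξ n ω ^ 2 ≤ x / (8 * lam n) := by
        have hq : 0 ≤ x / (8 * lam n) := div_nonneg hx.le (by linarith [hlam n])
        rw [← Real.sq_sqrt hq]
        exact sq_le_sq.2 ((abs_le.2 h2).trans (le_abs_self _))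
      rw [le_div_iff₀ (by linarith [hlam n])] at h3
      linarith
    have h2 : ∑ n ∈ H, lam n * ξ n ω ^ 2 ≤ r / 2 := by
      refine le_trans (Finset.sum_le_card_nsmul _ _ _ h1) (le_trans (le_of_eq ?_) hxr)
      rw [countingFunction_eq_card, nsmul_eq_mul]
      ring
    have hr : 0 ≤ r / 2 := le_trans (Finset.sum_nonneg fun n _ =>
      mul_nonneg (hlam n).le (sq_nonneg _)) h2
    have h3 : ∀ n, ENNReal.ofReal (lam n * ξ n ω ^ 2) =
        (if n ∈ H then ENNReal.ofReal (lam n * ξ n ω ^ 2) else 0) +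
          ENNReal.ofReal ((if n ∈ H then 0 else lam n) * ξ n ω ^ 2) := by
      intro n
      split_ifs <;> simp
    have h4 : T ω ≤ ENNReal.ofReal (r / 2) := hω.2
    show ∑' n, ENNReal.ofReal (lam n * ξ n ω ^ 2) ≤ ENNReal.ofReal r
    rw [tsum_congr h3, ENNReal.tsum_add, tsum_eq_sum (s := H) fun n hn => if_neg hn,
      Finset.sum_congr rfl fun n hn => if_pos hn, ← ENNReal.ofReal_sum_of_nonneg
      fun n _ => mul_nonneg (hlam n).le (sq_nonneg _), ← add_halves r, ENNReal.ofReal_add hr hr]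
    exact add_le_add (ENNReal.ofReal_le_ofReal h2) h4
  · refine Finset.measurableSet_biInter H fun n hn => ?_
    have h5 : MeasurableSet[m n] (ξ n ⁻¹' J n) := ⟨J n, measurableSet_Icc, rfl⟩
    exact le_iSup₂ (f := fun n (_ : n ∈ {n | n ∈ H}) => m n) n hn _ h5
  · have hTm : Measurable[⨆ n ∈ {n | n ∉ H}, m n] T := by
      simp only [hT, ENNReal.tsum_eq_iSup_sum]
      refine .iSup fun s => s.measurable_fun_sum fun n _ => ?_
      by_cases hn : n ∈ H
      · simp [hn]
      · have h6 : Measurable[⨆ n ∈ {n | n ∉ H}, m n] (ξ n) :=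
          (comap_measurable (ξ n)).mono
            (le_iSup₂ (f := fun n (_ : n ∈ {n | n ∉ H}) => m n) n hn) le_rfl
        simp only [hn, if_false]
        exact ((h6.pow_const 2).const_mul _).ennreal_ofReal
    exact measurableSet_le hTm measurable_const

lemma exists_le_log_smallBallProb [IsProbabilityMeasure P] (hξ : ∀ n, HasLaw (ξ n) (gaussianReal 0 1) P)
    (hm : ∀ n, Measurable (ξ n)) (hindep : iIndepFun ξ P)
    (hlam : ∀ n, 0 < lam n) (hfin : ∀ x : ℝ, 0 < x → {n : ℕ | x < lam n}.Finite)
    (hsv : SlowlyVaryingAtZero (countingFunction lam)) :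
    ∃ C : ℝ, ∀ᶠ x in 𝓝[>] (0 : ℝ), ∀ r : ℝ, x * countingFunction lam x / 4 ≤ r →
      0 < smallBallProb P lam ξ r ∧
      -(headLogSum lam x / 2) - C * countingFunction lam x - Real.log 2 ≤
        Real.log (smallBallProb P lam ξ r) := by
  classical
  obtain ⟨c, hc, hcs⟩ := exists_mul_le_gaussianReal_Icc
  -- Since log(c√(x/(8λ_n))) = -log(λ_n/x)/2 - (log 8/2 - log c), this is the loss per head index.
  refine ⟨Real.log 8 / 2 - Real.log c, ?_⟩
  filter_upwards [eventually_tsum_tail_le hlam hfin hsv, hsv.1, self_mem_nhdsWithin] with x ht hN hx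
  intro r hr
  have hx0 : 0 < x := hx
  have hr0 : 0 < r := (by positivity : 0 < x * countingFunction lam x / 4).trans_le hr
  have htail := half_le_measure_tail hξ hm hlam hr0
    (ht.trans (ENNReal.ofReal_le_ofReal (by linarith)))
  have hprod := measure_head_mul_measure_tail_le (r := r) hm hindep hlam hx0 (by linarith)
  set s : ℕ → ℝ := fun n => √(x / (8 * lam n)) with hs
  have hs0 : ∀ n, 0 < s n := fun n => Real.sqrt_pos.2 (div_pos hx0 (by linarith [hlam n]))
  have hhead : ENNReal.ofReal (∏ n ∈ headIndices lam x, c * s n) ≤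
      ∏ n ∈ headIndices lam x, P (ξ n ⁻¹' Set.Icc (-s n) (s n)) := by
    rw [ENNReal.ofReal_prod_of_nonneg fun n _ => (mul_pos hc (hs0 n)).le]
    refine Finset.prod_le_prod' fun n hn => ?_
    rw [mem_headIndices hfin hx0] at hn
    rw [← Measure.map_apply (hm n) measurableSet_Icc, (hξ n).map_eq]
    refine hcs _ ⟨(hs0 n).le, Real.sqrt_le_one.2 ?_⟩
    rw [div_le_one (by linarith [hlam n])]
    linarith [hlam n]
  have hp0 : 0 < ∏ n ∈ headIndices lam x, c * s n :=
    Finset.prod_pos fun n _ => mul_pos hc (hs0 n)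
  have hlow : (∏ n ∈ headIndices lam x, c * s n) * 2⁻¹ ≤ smallBallProb P lam ξ r := by
    unfold smallBallProb Measure.real
    rw [← ENNReal.ofReal_le_iff_le_toReal (measure_ne_top _ _), ENNReal.ofReal_mul hp0.le,
      ENNReal.ofReal_inv_of_pos two_pos, ENNReal.ofReal_ofNat]
    exact (mul_le_mul' hhead htail).trans hprod
  refine ⟨lt_of_lt_of_le (by positivity) hlow, ?_⟩
  refine le_trans (le_of_eq ?_) (Real.log_le_log (by positivity) hlow)
  rw [Real.log_mul hp0.ne' (by norm_num), Real.log_inv,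
    Real.log_prod fun n _ => (mul_pos hc (hs0 n)).ne', headLogSum, countingFunction_eq_card]
  have hterm : ∀ n, Real.log (c * s n) =
      -(Real.log (lam n / x) / 2) - (Real.log 8 / 2 - Real.log c) := by
    intro n
    have := hlam n
    rw [Real.log_mul hc.ne' (hs0 n).ne', hs, Real.log_sqrt (by positivity),
      Real.log_div hx0.ne' (by positivity), Real.log_mul (by norm_num) (by positivity),
      Real.log_div (by positivity) (by positivity)]
    ring
  simp_rw [hterm]
  rw [Finset.sum_sub_distrib, Finset.sum_neg_distrib, Finset.sum_div, Finset.sum_const,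
    nsmul_eq_mul]
  ring

end

/-! ### The logarithmic asymptotics -/

lemma Asymptotics.IsEquivalent.eventually_le_const_mul {α : Type*} {l : Filter α} {f g : α → ℝ}
    (h : f ~[l] g) (hg : ∀ᶠ t in l, 0 < g t) {a : ℝ} (ha : 1 < a) :
    ∀ᶠ t in l, f t ≤ a * g t := by
  filter_upwards [h.isLittleO.bound (sub_pos.2 ha), hg] with t ht hgt
  rw [Real.norm_of_nonneg hgt.le, Pi.sub_apply] at ht
  linarith [le_of_abs_le ht]

theorem theorem2 {Ω : Type*} [MeasurableSpace Ω] (P : Measure Ω) [IsProbabilityMeasure P]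
    (ξ : ℕ → Ω → ℝ) (hξ : ∀ n, HasLaw (ξ n) (gaussianReal 0 1) P) (hindep : iIndepFun ξ P)
    (lam : ℕ → ℝ) (hlam : ∀ n, 0 < lam n)
    (φ : ℝ → ℝ) (hφ : SlowlyVaryingAtZero φ)
    (hφint : ∀ x : ℝ, 0 < x → IntegrableOn φ (Set.Icc x 1) volume)
    (hN : countingFunction lam ~[𝓝[>] (0 : ℝ)] φ)
    (u : ℝ → ℝ) (hu : Tendsto u (𝓝[>] (0 : ℝ)) atTop)
    (hur : (fun r => φ (1 / u r) / (2 * u r)) ~[𝓝[>] (0 : ℝ)] fun r => r) :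
    (fun r => Real.log (smallBallProb P lam ξ r)) ~[𝓝[>] (0 : ℝ)]
      fun r => -(1 / 2) * ∫ z in (1 / u r)..1, φ z / z := by
  have hsv := hφ.of_isEquivalent hN
  have hfin : ∀ x : ℝ, 0 < x → {n : ℕ | x < lam n}.Finite := fun x hx =>
    finite_setOf_lt_of_eventually_pos hsv.1 hx
  -- `HasLaw` gives only a.e. measurability; measurable versions are needed for the generated
  -- σ-algebras.
  obtain ⟨η, hηm, hη⟩ : ∃ η : ℕ → Ω → ℝ, (∀ n, Measurable (η n)) ∧ ∀ n, ξ n =ᵐ[P] η n :=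
    ⟨fun n => (hξ n).aemeasurable.mk _, fun n => (hξ n).aemeasurable.measurable_mk,
      fun n => (hξ n).aemeasurable.ae_eq_mk⟩
  have hηlaw : ∀ n, HasLaw (η n) (gaussianReal 0 1) P := fun n => (hξ n).congr (hη n).symm
  have hηind : iIndepFun η P := hindep.congr hη
  simp_rw [smallBallProb_congr hη]
  obtain ⟨C, hC⟩ := exists_le_log_smallBallProb hηlaw hηm hηind hlam hfin hsv
  have hm : Tendsto (fun r => 1 / u r) (𝓝[>] 0) (𝓝[>] 0) := by
    simpa only [one_div] using! tendsto_inv_atTop_nhdsGT_zero.comp hu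
  have hI := (integral_div_isEquivalent_headLogSum hlam hfin hsv hφint hN.symm).comp_tendsto hm
  have hNS := (countingFunction_isLittleO_headLogSum hfin hsv).comp_tendsto hm
  have hS := (headLogSum_tendsto_atTop hlam hfin hsv).comp hm
  have hr : (fun r => 1 / u r * countingFunction lam (1 / u r) / 2) ~[𝓝[>] (0 : ℝ)] fun r => r := by
    refine IsEquivalent.trans ?_ hur
    have h := (hN.comp_tendsto hm).mul (IsEquivalent.refl (u := fun r => 1 / u r / 2) (l := 𝓝[>] 0))
    convert! h using 2
    · simp only [Pi.mul_apply, Function.comp]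
      ring
    · simp only [Pi.mul_apply, Function.comp]
      ring
  have hpos : ∀ᶠ r : ℝ in 𝓝[>] 0, 0 < r := self_mem_nhdsWithin
  -- From r ~ x N(x)/2: `hlo` gives x N(x)/4 ≤ r for the lower bound, and `hhi` gives r/x ≤ N(x) for
  -- the Chernoff factor.
  have hlo := hr.eventually_le_const_mul hpos one_lt_two
  have hhi := hr.symm.eventually_le_const_mul (hr.eventually_pos hpos) one_lt_two
  have hlog : (fun _ : ℝ => Real.log 2) =o[𝓝[>] (0 : ℝ)] (headLogSum lam ∘ fun r => 1 / u r) :=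
    isLittleO_const_left.2 (Or.inr (tendsto_norm_atTop_atTop.comp hS))
  have herr : (fun r => Real.log (smallBallProb P lam η r) + headLogSum lam (1 / u r) / 2)
      =o[𝓝[>] (0 : ℝ)] (headLogSum lam ∘ fun r => 1 / u r) := by
    -- The two bounds combine to |log P + S/2| ≤ (|C| + 1) N + log 2.
    refine IsBigO.trans_isLittleO (IsBigO.of_bound 1 ?_)
      ((hNS.const_mul_left (|C| + 1)).add hlog)
    filter_upwards [hlo, hhi, hpos, hm.eventually hC, hm self_mem_nhdsWithin] with r h1 h2 h3 h4 h5
    obtain ⟨hp, hlow⟩ := h4 r (by linarith)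
    have hx : 0 < 1 / u r := h5
    have hup := Real.log_le_log hp (smallBallProb_le hηlaw hηind hlam h3.le hx)
    rw [Real.log_exp] at hup
    have h6 : r / (1 / u r) ≤ countingFunction lam (1 / u r) := by
      rw [div_le_iff₀ hx]
      linarith
    have hN0 := countingFunction_nonneg lam (1 / u r)
    have h7 : C * countingFunction lam (1 / u r) ≤ |C| * countingFunction lam (1 / u r) :=
      mul_le_mul_of_nonneg_right (le_abs_self C) hN0
    have h8 := mul_nonneg (abs_nonneg C) hN0
    have h9 := Real.log_nonneg one_le_two
    simp only [Function.comp]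
    rw [one_mul, Real.norm_eq_abs, Real.norm_of_nonneg (by nlinarith), abs_le]
    constructor <;> linarith
  have hhalf : ∀ {f : ℝ → ℝ}, f ~[𝓝[>] (0 : ℝ)] (headLogSum lam ∘ fun r => 1 / u r) →
      (fun r => -(1 / 2) * f r) ~[𝓝[>] (0 : ℝ)]
        fun r => -(1 / 2) * (headLogSum lam ∘ fun r => 1 / u r) r := fun h =>
    (IsEquivalent.refl (u := fun _ : ℝ => (-(1 / 2) : ℝ))).mul h
  refine IsEquivalent.trans ?_ (hhalf hI).symm
  refine IsLittleO.congr_left ?_ (f₁ := fun r =>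
    Real.log (smallBallProb P lam η r) + headLogSum lam (1 / u r) / 2) fun r => ?_
  · exact (isLittleO_const_mul_right_iff (by norm_num)).2 herr
  · simp only [Pi.sub_apply, Function.comp]
    ring
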